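/- Let $D=\{z\in\mathbb C:|z|<1\}$, $\overline D$ its closure and $T=\{z:|z|=1\}$. Let $\chi$ be the chordal metric on $\mathbb C\cup\{\infty\}$, $$\chi(z,w)=\frac{|z-w|}{\sqrt{1+|z|^2}\sqrt{1+|w|^2}},\qquad \chi(z,\infty)=\chi(\infty,z)=\frac1{\sqrt{1+|z|^2}}\quad(z,w\in\mathbb C),\qquad \chi(\infty,\infty)=0 .$$ Let $\tilde A(D)$ be the set of all functions $f:\overline D\to\mathbb C\cup\{\infty\}$ such that either $f\equiv\infty$, or $f$ is continuous with respect to $\chi$, $f(D)\subset\mathbb C$ and $f|_D$ is holomorphic; endow it with the metric $\tilde d(f,g)=\max_{|z|\le1}\chi(f(z),g(z))$. For $f\in\tilde A(D)$ put $$E_f=\{\zeta\in T: f(\zeta)\notin f(D)\}.$$ A Hausdorff measure function is a nondecreasing function $h:[0,\infty)\to[0,\infty)$ with $h(0)=0$ and $\lim_{t\to0^+}h(t)=0$; for $E\subset\mathbb C$ let $$\Lambda_h(E)=\lim_{\delta\to0^+}\ \inf\Big\{\sum_n h(r_n)\ :\ E\subset\bigcup_n D_n,\ D_n \text{ open discs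 of radius } r_n\le\delta\Big\},$$ the infimum being over countable coverings. Then for every Hausdorff measure function $h$ the set $\{f\in\tilde A(D):\Lambda_h(E_f)=0\}$ is dense and $G_\delta$ in $\tilde A(D)$. Moreover, for generic $f\in\tilde A(D)$ (that is, for all $f$ in a residual subset of $\tilde A(D)$) the set $E_f$ has zero length (arc length measure on $T$). -/

import Mathlib

open scoped NNReal ENNReal Topology

noncomputable section

/-- The extended plane `ℂ ∪ {∞}`.  It is a separate copy of `OnePoint ℂ`, because its topology
is going to be the one of the chordal metric. -/
def ExtendedPlane : Type := OnePoint ℂ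

namespace ExtendedPlane

/-- The point at infinity. -/
def infty : ExtendedPlane := (OnePoint.infty : OnePoint ℂ)

/-- The inclusion of `ℂ` in `ℂ ∪ {∞}`. -/
def ofComplex (z : ℂ) : ExtendedPlane := (OnePoint.some z : OnePoint ℂ)

/-- The chordal metric `χ`. -/
def chordal : ExtendedPlane → ExtendedPlane → ℝ
  | some z, some w => ‖z - w‖ / (√(1 + ‖z‖ ^ 2) * √(1 + ‖w‖ ^ 2))
  | some z, none => 1 / √(1 + ‖z‖ ^ 2)
  | none, some w => 1 / √(1 + ‖w‖ ^ 2)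
  | none, none => 0

theorem chordal_ofComplex (z w : ℂ) : chordal (ofComplex z) (ofComplex w) =
    ‖z - w‖ / (√(1 + ‖z‖ ^ 2) * √(1 + ‖w‖ ^ 2)) := rfl

theorem chordal_ofComplex_infty (z : ℂ) :
    chordal (ofComplex z) infty = 1 / √(1 + ‖z‖ ^ 2) := rfl

theorem chordal_infty_ofComplex (z : ℂ) :
    chordal infty (ofComplex z) = 1 / √(1 + ‖z‖ ^ 2) := rfl

theorem chordal_infty_infty : chordal infty infty = 0 := rfl

/-- Every point of `ℂ ∪ {∞}` is finite or `∞`. -/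
theorem cases_on_point {P : ExtendedPlane → Prop} (hinf : P infty)
    (hfin : ∀ z, P (ofComplex z)) (p : ExtendedPlane) : P p :=
  match p with
  | none => hinf
  | some z => hfin z

/-- Stereographic projection onto the sphere of radius `1 / 2` in `ℂ × ℝ`; it is only used to
prove the triangle inequality for `χ`. -/
def stereo : ExtendedPlane → WithLp 2 (ℂ × ℝ)
  | some z => WithLp.toLp 2 (((1 / (1 + ‖z‖ ^ 2) : ℝ) : ℂ) * z, 1 / 2 - 1 / (1 + ‖z‖ ^ 2))
  | none => WithLp.toLp 2 (0, 1 / 2)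

theorem dist_sq (a b : ℂ) (s t : ℝ) :
    dist (WithLp.toLp 2 (a, s) : WithLp 2 (ℂ × ℝ)) (WithLp.toLp 2 (b, t)) =
      √(‖a - b‖ ^ 2 + (s - t) ^ 2) := by
  rw [WithLp.prod_dist_eq_of_L2]
  simp [dist_eq_norm]

theorem chordal_eq_dist_stereo (p q : ExtendedPlane) :
    chordal p q = dist (stereo p) (stereo q) := by
  induction p using cases_on_point with
  | hinf =>
    induction q using cases_on_point with
    | hinf => rw [dist_self, chordal_infty_infty]
    | hfin w =>
      have hw : 0 < 1 + ‖w‖ ^ 2 := by positivity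
      rw [chordal_infty_ofComplex]
      change _ = dist (WithLp.toLp 2 (0, 1 / 2) : WithLp 2 (ℂ × ℝ)) (WithLp.toLp 2 (_, _))
      rw [dist_sq, zero_sub, norm_neg, norm_mul, Complex.norm_real, Real.norm_eq_abs, mul_pow,
        sq_abs, ← Real.sqrt_one, ← Real.sqrt_div zero_le_one, Real.sqrt_one]
      congr 1
      field_simp
      ring
  | hfin z =>
    have hz : 0 < 1 + ‖z‖ ^ 2 := by positivity
    induction q using cases_on_point with
    | hinf =>
      rw [chordal_ofComplex_infty]
      change _ = dist (WithLp.toLp 2 (_, _) : WithLp 2 (ℂ × ℝ)) (WithLp.toLp 2 (0, 1 / 2))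
      rw [dist_sq, sub_zero, norm_mul, Complex.norm_real, Real.norm_eq_abs, mul_pow,
        sq_abs, ← Real.sqrt_one, ← Real.sqrt_div zero_le_one, Real.sqrt_one]
      congr 1
      field_simp
      ring
    | hfin w =>
      have hw : 0 < 1 + ‖w‖ ^ 2 := by positivity
      rw [chordal_ofComplex]
      change _ = dist (WithLp.toLp 2 (_, _) : WithLp 2 (ℂ × ℝ)) (WithLp.toLp 2 (_, _))
      rw [dist_sq, ← Real.sqrt_mul hz.le, ← Real.sqrt_sq (norm_nonneg (z - w)),
        ← Real.sqrt_div (sq_nonneg _)]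
      congr 1
      simp only [Complex.sq_norm, Complex.normSq_apply] at hz hw ⊢
      simp only [Complex.sub_re, Complex.sub_im, Complex.re_ofReal_mul, Complex.im_ofReal_mul]
      field_simp
      ring

theorem eq_of_chordal_eq_zero {p q : ExtendedPlane} (h : chordal p q = 0) : p = q := by
  revert h
  induction p using cases_on_point with
  | hinf =>
    induction q using cases_on_point with
    | hinf => intro _; rfl
    | hfin w =>
      rw [chordal_infty_ofComplex]
      intro h
      have : 0 < 1 / √(1 + ‖w‖ ^ 2) := by positivity
      exact absurd h this.ne'
  | hfin z =>
    induction q using cases_on_point with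
    | hinf =>
      rw [chordal_ofComplex_infty]
      intro h
      have : 0 < 1 / √(1 + ‖z‖ ^ 2) := by positivity
      exact absurd h this.ne'
    | hfin w =>
      rw [chordal_ofComplex]
      intro h
      have h2 : √(1 + ‖z‖ ^ 2) * √(1 + ‖w‖ ^ 2) ≠ 0 := by positivity
      rw [div_eq_zero_iff, or_iff_left h2, norm_eq_zero, sub_eq_zero] at h
      rw [h]

instance : MetricSpace ExtendedPlane where
  dist := chordal
  dist_self p := by rw [chordal_eq_dist_stereo, dist_self]
  dist_comm p q := by simp only [chordal_eq_dist_stereo, dist_comm]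
  dist_triangle p q r := by
    simp only [chordal_eq_dist_stereo]
    exact dist_triangle _ _ _
  eq_of_dist_eq_zero := eq_of_chordal_eq_zero

theorem dist_eq_chordal (p q : ExtendedPlane) : dist p q = chordal p q := rfl

end ExtendedPlane

/-- The closed unit disc. -/
abbrev ClosedDisc : Type := Metric.closedBall (0 : ℂ) 1

/-- The class `Ã(D)`: functions from the closed unit disc to `ℂ ∪ {∞}`, continuous for the chordal
metric, which are either identically `∞`, or finite and holomorphic in the open unit disc.
As a subtype of the continuous maps on a compact space it carries the metric
`d(f, g) = max_{|z| ≤ 1} χ(f(z), g(z))`, see `ExtendedDiscAlgebra.dist_eq`. -/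
def ExtendedDiscAlgebra : Type :=
  {f : C(ClosedDisc, ExtendedPlane) //
    (∀ z, f z = ExtendedPlane.infty) ∨
    ∃ g : ℂ → ℂ, DifferentiableOn ℂ g (Metric.ball 0 1) ∧
      ∀ z : ClosedDisc, ‖(z : ℂ)‖ < 1 → f z = ExtendedPlane.ofComplex (g z)}

namespace ExtendedDiscAlgebra

instance : MetricSpace ExtendedDiscAlgebra :=
  inferInstanceAs (MetricSpace {_f : C(ClosedDisc, ExtendedPlane) // _})

instance : CoeFun ExtendedDiscAlgebra (fun _ => ClosedDisc → ExtendedPlane) :=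
  ⟨fun f => f.1⟩

theorem dist_eq (f g : ExtendedDiscAlgebra) :
    dist f g = ⨆ z : ClosedDisc, ExtendedPlane.chordal (f z) (g z) :=
  ContinuousMap.dist_eq_iSup (f := f.1) (g := g.1)

/-- `E_f = {ζ ∈ T : f(ζ) ∉ f(D)}`, as a subset of the plane. -/
def exceptionalSet (f : ExtendedDiscAlgebra) : Set ℂ :=
  Subtype.val '' {ζ : ClosedDisc | ‖(ζ : ℂ)‖ = 1 ∧ f ζ ∉ f '' {z : ClosedDisc | ‖(z : ℂ)‖ < 1}}

end ExtendedDiscAlgebra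

/-- Hausdorff measure functions: nondecreasing functions `h : [0, ∞) → [0, ∞)` with `h(0) = 0` and
`h(t) → 0` as `t → 0`. -/
structure IsHausdorffMeasureFunction (h : ℝ≥0 → ℝ≥0) : Prop where
  mono : Monotone h
  map_zero : h 0 = 0
  tendsto_zero : Filter.Tendsto h (𝓝 0) (𝓝 0)

/-- The infimum of `∑ h(r_n)` over all coverings of `E` by open discs of radii `r_n ≤ δ`.
Finite coverings are included, since discs of radius `0` are empty and `h(0) = 0`. -/
def hausdorffPremeasure (h : ℝ≥0 → ℝ≥0) (δ : ℝ≥0) (E : Set ℂ) : ℝ≥0∞ :=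
  ⨅ (c : ℕ → ℂ) (r : ℕ → ℝ≥0) (_ : ∀ n, r n ≤ δ) (_ : E ⊆ ⋃ n, Metric.ball (c n) (r n)),
    ∑' n, (h (r n) : ℝ≥0∞)

/-- The Hausdorff measure `Λ_h(E)`, the limit (supremum) of the above as `δ → 0`. -/
def hausdorffLambda (h : ℝ≥0 → ℝ≥0) (E : Set ℂ) : ℝ≥0∞ :=
  ⨆ (δ : ℝ≥0) (_ : 0 < δ), hausdorffPremeasure h δ E

/-- The length (arc length measure) of a subset of the unit circle. -/
def circleLength (E : Set ℂ) : ℝ≥0∞ :=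
  MeasureTheory.volume {θ : ℝ | θ ∈ Set.Ico 0 (2 * Real.pi) ∧ Complex.exp (θ * Complex.I) ∈ E}

end

/-! ### Hausdorff measures and length -/

/-! The $G_\delta$ part rests on stability. If a nonconstant $f$ takes at $\zeta\in T$ a value
$f(z_0)$ with $|z_0|<1$, a quantitative open mapping theorem on a small disc about $z_0$ shows that
every $g$ near $f$ does the same at every point near $\zeta$ (`eventually_mem_image`). By
compactness of $T\setminus U$, the nonconstant $f$ with $E_f\subset U$ form an open set for each
open $U$. Vanishing of $\Lambda_h(E_f)$ amounts to countably many conditions, each asking for a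
cheap open covering, hence each open on nonconstant functions. Constants have $E_f=\emptyset$ and
form a closed set.

For density, the disc algebra is dense in $\tilde A(D)$ and complete in the uniform metric, so
Baire's theorem there reduces the claim to meeting one condition at a time. Given $F$ and
$\varepsilon$, take a finite net $t\subset T$ so fine that $F$ is almost constant at its scale, and
add $\varepsilon$ times a sum of bumps concentrated near the points of $t$
(`forall_exists_eq_of_add_decaySum`). Near $\zeta\in t$ the bump makes the new function cover a disc
of radius comparable to $\varepsilon$ about a value close to $F(\zeta)$, using only points of $D$.
Away from $t$ the bumps are negligible, so boundary values lie in these discs. Thus the exceptional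
set lies in `t.card` discs of radius $\rho$, where $\rho$ may be chosen after $t$, so that the total
cost is as small as desired.

The statement on length is the case $h(t)=t$, since a disc of radius $r$ meets $T$ in length at most
$2\pi r$. -/

theorem hausdorffPremeasure_anti (h : ℝ≥0 → ℝ≥0) {δ δ' : ℝ≥0} (hδ : δ ≤ δ') (E : Set ℂ) :
    hausdorffPremeasure h δ' E ≤ hausdorffPremeasure h δ E := by
  unfold hausdorffPremeasure
  gcongr with c r
  exact iInf_mono' fun hr => ⟨fun n => (hr n).trans hδ, le_rfl⟩

theorem hausdorffPremeasure_lt_iff {h : ℝ≥0 → ℝ≥0} {δ : ℝ≥0} {E : Set ℂ} {a : ℝ≥0∞} :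
    hausdorffPremeasure h δ E < a ↔ ∃ (c : ℕ → ℂ) (r : ℕ → ℝ≥0), (∀ n, r n ≤ δ) ∧
      E ⊆ ⋃ n, Metric.ball (c n) (r n) ∧ ∑' n, (h (r n) : ℝ≥0∞) < a := by
  simp only [hausdorffPremeasure, iInf_lt_iff, exists_prop]

theorem hausdorffPremeasure_le_card_mul {h : ℝ≥0 → ℝ≥0} (h0 : h 0 = 0) {δ ρ : ℝ≥0} (hρ : ρ ≤ δ)
    {E : Set ℂ} (t : Finset ℂ) (hE : E ⊆ ⋃ c ∈ t, Metric.ball c ρ) :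
    hausdorffPremeasure h δ E ≤ t.card * h ρ := by
  let e := t.equivFin
  -- The finite covering is padded with discs of radius `0`, which are empty and cost `h 0 = 0`.
  let c : ℕ → ℂ := fun n => if hn : n < t.card then (e.symm ⟨n, hn⟩ : ℂ) else 0
  let r : ℕ → ℝ≥0 := fun n => if n < t.card then ρ else 0
  have hsum : ∑' n, (h (r n) : ℝ≥0∞) = t.card * h ρ := by
    rw [tsum_eq_sum (s := Finset.range t.card)]
    · rw [Finset.sum_congr rfl (g := fun _ => (h ρ : ℝ≥0∞))]
      · simp
      · intro n hn
        simp [r, Finset.mem_range.1 hn]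
    · intro n hn
      rw [Finset.mem_range] at hn
      simp [r, hn, h0]
  rw [← hsum]
  refine iInf_le_of_le c (iInf_le_of_le r (iInf_le_of_le ?_ (iInf_le_of_le ?_ le_rfl)))
  · intro n
    by_cases hn : n < t.card <;> simp [r, hn, hρ]
  · intro z hz
    obtain ⟨x, hx, hzx⟩ := Set.mem_iUnion₂.1 (hE hz)
    refine Set.mem_iUnion.2 ⟨e ⟨x, hx⟩, ?_⟩
    simpa [c, r] using hzx

/-- Using one parameter both as scale and as bound loses nothing, because the premeasure grows as
the scale shrinks. The countable strict form is what exhibits a $G_\delta$. -/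
theorem hausdorffLambda_eq_zero_iff {h : ℝ≥0 → ℝ≥0} {E : Set ℂ} :
    hausdorffLambda h E = 0 ↔
      ∀ n : ℕ, hausdorffPremeasure h ((n + 1 : ℝ≥0)⁻¹) E < ((n + 1 : ℝ≥0)⁻¹ : ℝ≥0) := by
  constructor
  · intro hE n
    have hpos : (0 : ℝ≥0) < (n + 1 : ℝ≥0)⁻¹ := by positivity
    have := le_iSup₂ (f := fun (δ : ℝ≥0) (_ : 0 < δ) => hausdorffPremeasure h δ E) _ hpos
    refine (this.trans hE.le).trans_lt ?_
    exact_mod_cast hpos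
  · intro hE
    refine le_antisymm (iSup₂_le fun δ hδ => ?_) bot_le
    by_contra hcon
    set ε := hausdorffPremeasure h δ E with hεdef
    have hε : 0 < ε := not_le.1 hcon
    have hm : 0 < min (δ : ℝ≥0∞) ε := lt_min (by exact_mod_cast hδ) hε
    obtain ⟨n, hn⟩ := ENNReal.exists_inv_nat_lt hm.ne'
    have hle : (((n + 1 : ℝ≥0)⁻¹ : ℝ≥0) : ℝ≥0∞) ≤ (n : ℝ≥0∞)⁻¹ := by
      rw [ENNReal.coe_inv (by positivity)]
      gcongr
      simp
    have h1 := hle.trans_lt hn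
    refine lt_irrefl ε
      ((hausdorffPremeasure_anti h (δ := (n + 1 : ℝ≥0)⁻¹) ?_ E).trans_lt ((hE n).trans ?_))
    · exact_mod_cast (h1.trans_le (min_le_left _ _)).le
    · exact h1.trans_le (min_le_right _ _)

theorem hausdorffLambda_empty {h : ℝ≥0 → ℝ≥0} (h0 : h 0 = 0) : hausdorffLambda h ∅ = 0 := by
  rw [hausdorffLambda_eq_zero_iff]
  intro n
  refine (hausdorffPremeasure_le_card_mul h0 le_rfl ∅ (Set.empty_subset _)).trans_lt ?_
  simp

theorem isHausdorffMeasureFunction_id : IsHausdorffMeasureFunction id :=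
  ⟨monotone_id, rfl, Filter.tendsto_id⟩

/-- The chord is $2|\sin((\theta-\varphi)/2)|$, and Jordan's inequality bounds the sine from below.
-/
theorem abs_sub_le_pi_mul_norm_exp_sub {θ φ : ℝ} (h : |θ - φ| ≤ Real.pi) :
    |θ - φ| ≤ Real.pi / 2 * ‖Complex.exp (θ * Complex.I) - Complex.exp (φ * Complex.I)‖ := by
  have h1 : Complex.exp (θ * Complex.I) - Complex.exp (φ * Complex.I) =
      Complex.exp (φ * Complex.I) * (Complex.exp (Complex.I * ((θ - φ : ℝ) : ℂ)) - 1) := by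
    rw [mul_sub, ← Complex.exp_add, mul_one]
    congr 2
    push_cast
    ring
  rw [h1, norm_mul, Complex.norm_exp_ofReal_mul_I, one_mul, Complex.norm_exp_I_mul_ofReal_sub_one,
    norm_mul, Real.norm_eq_abs, Real.norm_eq_abs, abs_two]
  have h2 := Real.mul_abs_le_abs_sin (x := (θ - φ) / 2)
    (by rw [abs_div, abs_two]; linarith)
  rw [abs_div, abs_two] at h2
  have hpi := Real.pi_pos
  have : 2 / Real.pi * (|θ - φ| / 2) = |θ - φ| / Real.pi := by field_simp
  rw [this, div_le_iff₀ hpi] at h2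
  linarith

/-- On a half circle angles differ by at most $\pi$, so the chord estimate applies; chords inside
the disc are shorter than $2r$. -/
theorem volume_arc_inter_ball_le (a : ℝ) (c : ℂ) (r : ℝ≥0) :
    MeasureTheory.volume {θ : ℝ | θ ∈ Set.Ico a (a + Real.pi) ∧
      Complex.exp (θ * Complex.I) ∈ Metric.ball c r} ≤ ENNReal.ofReal Real.pi * r := by
  refine (Real.volume_le_diam _).trans (Metric.ediam_le ?_)
  rintro θ ⟨⟨h1, h2⟩, h3⟩ φ ⟨⟨h4, h5⟩, h6⟩
  have hd : |θ - φ| ≤ Real.pi := by rw [abs_le]; constructor <;> linarith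
  have key := abs_sub_le_pi_mul_norm_exp_sub hd
  rw [Metric.mem_ball] at h3 h6
  have h7 := dist_triangle_right (Complex.exp (θ * Complex.I)) (Complex.exp (φ * Complex.I)) c
  rw [dist_eq_norm] at h7
  rw [edist_dist, Real.dist_eq, ← ENNReal.ofReal_coe_nnreal (p := r),
    ← ENNReal.ofReal_mul Real.pi_pos.le]
  refine ENNReal.ofReal_le_ofReal (key.trans ?_)
  have hpi := Real.pi_pos
  nlinarith

theorem circleLength_ball_le (c : ℂ) (r : ℝ≥0) :
    circleLength (Metric.ball c r) ≤ ENNReal.ofReal (2 * Real.pi) * r := by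
  have hpi := Real.pi_pos
  rw [circleLength, two_mul, ENNReal.ofReal_add hpi.le hpi.le, add_mul]
  refine (MeasureTheory.measure_mono ?_).trans ((MeasureTheory.measure_union_le _ _).trans
    (add_le_add (volume_arc_inter_ball_le 0 c r) (volume_arc_inter_ball_le Real.pi c r)))
  rintro θ ⟨⟨h1, h2⟩, h3⟩
  rcases lt_or_ge θ Real.pi with h | h
  · exact Or.inl ⟨⟨h1, by linarith⟩, h3⟩
  · exact Or.inr ⟨⟨h, h2⟩, h3⟩

theorem circleLength_mono {E F : Set ℂ} (h : E ⊆ F) : circleLength E ≤ circleLength F :=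
  MeasureTheory.measure_mono fun _ hθ => ⟨hθ.1, h hθ.2⟩

theorem circleLength_iUnion_le (E : ℕ → Set ℂ) :
    circleLength (⋃ n, E n) ≤ ∑' n, circleLength (E n) := by
  refine (MeasureTheory.measure_mono ?_).trans (MeasureTheory.measure_iUnion_le _)
  rintro θ ⟨h1, h2⟩
  obtain ⟨n, hn⟩ := Set.mem_iUnion.1 h2
  exact Set.mem_iUnion.2 ⟨n, h1, hn⟩

theorem circleLength_le_hausdorffPremeasure (δ : ℝ≥0) (E : Set ℂ) :
    circleLength E ≤ ENNReal.ofReal (2 * Real.pi) * hausdorffPremeasure id δ E := by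
  have hpi := Real.pi_pos
  have h0 : ENNReal.ofReal (2 * Real.pi) ≠ 0 := by
    rw [Ne, ENNReal.ofReal_eq_zero]; linarith
  rw [mul_comm, ← ENNReal.div_le_iff h0 ENNReal.ofReal_ne_top]
  refine le_iInf fun c => le_iInf fun r => le_iInf fun _ => le_iInf fun hE => ?_
  rw [ENNReal.div_le_iff h0 ENNReal.ofReal_ne_top, mul_comm, ← ENNReal.tsum_mul_left]
  exact (circleLength_mono hE).trans ((circleLength_iUnion_le _).trans
    (ENNReal.tsum_le_tsum fun n => circleLength_ball_le _ _))

theorem circleLength_eq_zero_of_hausdorffLambda_id {E : Set ℂ} (h : hausdorffLambda id E = 0) :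
    circleLength E = 0 := by
  have h1 : hausdorffPremeasure id 1 E = 0 := by
    refine le_antisymm ?_ bot_le
    rw [← h]
    exact le_iSup₂ (f := fun (δ : ℝ≥0) (_ : 0 < δ) => hausdorffPremeasure id δ E) 1 one_pos
  simpa [h1] using circleLength_le_hausdorffPremeasure 1 E

/-! ### The extended plane -/

namespace ExtendedPlane

/-- The finite part of a point of the extended plane, with the value `0` at `∞`. -/
def toComplex : ExtendedPlane → ℂ
  | some z => z
  | none => 0

@[simp]
theorem toComplex_ofComplex (z : ℂ) : toComplex (ofComplex z) = z := rfl

theorem ofComplex_ne_infty (z : ℂ) : ofComplex z ≠ infty := OnePoint.coe_ne_infty z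

theorem ofComplex_injective : Function.Injective ofComplex :=
  Function.LeftInverse.injective toComplex_ofComplex

theorem ofComplex_toComplex {p : ExtendedPlane} (hp : p ≠ infty) : ofComplex (toComplex p) = p := by
  induction p using cases_on_point with
  | hinf => exact absurd rfl hp
  | hfin z => rfl

/-- This identity turns chordal convergence at a finite point into Euclidean convergence. -/
theorem dist_toComplex {p q : ExtendedPlane} (hp : p ≠ infty) (hq : q ≠ infty) :
    dist (toComplex p) (toComplex q) = dist p q / (dist p infty * dist q infty) := by
  obtain ⟨z, rfl⟩ : ∃ z, ofComplex z = p := ⟨_, ofComplex_toComplex hp⟩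
  obtain ⟨w, rfl⟩ : ∃ w, ofComplex w = q := ⟨_, ofComplex_toComplex hq⟩
  simp only [dist_eq_chordal, chordal_ofComplex, chordal_ofComplex_infty, toComplex_ofComplex,
    dist_eq_norm]
  have hz : 0 < √(1 + ‖z‖ ^ 2) := by positivity
  have hw : 0 < √(1 + ‖w‖ ^ 2) := by positivity
  field_simp

theorem dist_ofComplex_le (z w : ℂ) : dist (ofComplex z) (ofComplex w) ≤ dist z w := by
  rw [dist_eq_chordal, chordal_ofComplex, dist_eq_norm]
  refine div_le_self (norm_nonneg _) (one_le_mul_of_one_le_of_one_le ?_ ?_) <;>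
  · rw [Real.one_le_sqrt]
    exact le_add_of_nonneg_right (sq_nonneg _)

theorem lipschitzWith_ofComplex : LipschitzWith 1 ofComplex :=
  LipschitzWith.of_dist_le_mul fun z w => by simpa using dist_ofComplex_le z w

theorem continuous_ofComplex : Continuous ofComplex := lipschitzWith_ofComplex.continuous

theorem dist_ofComplex_infty_le {z : ℂ} {n : ℕ} (hz : ‖z‖ = n + 1) :
    dist (ofComplex z) infty ≤ 1 / (n + 1) := by
  rw [dist_eq_chordal, chordal_ofComplex_infty]
  refine one_div_le_one_div_of_le (by positivity) (Real.le_sqrt_of_sq_le ?_)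
  rw [hz]
  linarith

theorem continuousAt_toComplex {p : ExtendedPlane} (hp : p ≠ infty) : ContinuousAt toComplex p := by
  rw [ContinuousAt, tendsto_iff_dist_tendsto_zero]
  have h1 : Filter.Tendsto (fun q => dist q p / (dist q infty * dist p infty)) (𝓝 p)
      (𝓝 (dist p p / (dist p infty * dist p infty))) := by
    have : dist p infty * dist p infty ≠ 0 := mul_ne_zero (dist_ne_zero.2 hp) (dist_ne_zero.2 hp)
    refine ContinuousAt.tendsto (f := fun q => dist q p / (dist q infty * dist p infty)) ?_
    fun_prop (disch := exact this)
  rw [dist_self, zero_div] at h1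
  refine h1.congr' ?_
  filter_upwards [isOpen_ne.mem_nhds hp] with q hq
  rw [dist_toComplex hq hp]

end ExtendedPlane

/-! ### The closed disc -/

namespace ClosedDisc

/-- The radial retraction of the plane onto the closed disc. -/
noncomputable def clamp (z : ℂ) : ClosedDisc :=
  ⟨z / (max 1 ‖z‖ : ℝ), by
    rw [mem_closedBall_zero_iff, norm_div, Complex.norm_real, Real.norm_eq_abs,
      abs_of_pos (by positivity)]
    exact div_le_one_of_le₀ (le_max_right _ _) (by positivity)⟩

theorem coe_clamp {z : ℂ} (hz : ‖z‖ ≤ 1) : (clamp z : ℂ) = z := by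
  simp [clamp, max_eq_left hz]

theorem clamp_coe (z : ClosedDisc) : clamp (z : ℂ) = z :=
  Subtype.ext (coe_clamp (mem_closedBall_zero_iff.1 z.2))

theorem norm_coe_le (z : ClosedDisc) : ‖(z : ℂ)‖ ≤ 1 := mem_closedBall_zero_iff.1 z.2

theorem continuous_clamp : Continuous clamp := by
  refine Continuous.subtype_mk (continuous_id.div (by fun_prop) fun z => ?_) _
  have : (0 : ℝ) < max 1 ‖z‖ := by positivity
  exact_mod_cast this.ne'

/-- A continuous function on the closed disc is constant if it is so in the open disc. -/
theorem eq_const_of_eq_const_of_norm_lt {Y : Type*} [TopologicalSpace Y] [T2Space Y]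
    {f : ClosedDisc → Y} (hf : Continuous f) {c : Y} (h : ∀ z : ClosedDisc, ‖(z : ℂ)‖ < 1 → f z = c)
    (z : ClosedDisc) : f z = c := by
  have h1 : Filter.Tendsto (fun r : ℝ => f (clamp (r * z))) (𝓝[<] 1) (𝓝 (f z)) := by
    have : Continuous fun r : ℝ => f (clamp (r * z)) :=
      hf.comp (continuous_clamp.comp (by fun_prop))
    have h2 := this.tendsto 1
    simp only [Complex.ofReal_one, one_mul, clamp_coe] at h2
    exact h2.mono_left nhdsWithin_le_nhds
  refine tendsto_nhds_unique h1 (tendsto_const_nhds.congr' ?_)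
  filter_upwards [Ioo_mem_nhdsLT (zero_lt_one' ℝ)] with r hr
  have h2 : ‖(r : ℂ) * z‖ < 1 := by
    rw [norm_mul, Complex.norm_real, Real.norm_eq_abs, abs_of_pos hr.1]
    nlinarith [norm_coe_le z, hr.1, hr.2, norm_nonneg (z : ℂ)]
  exact (h _ (by rwa [coe_clamp h2.le])).symm

end ClosedDisc

/-! ### Values of holomorphic functions near a point -/

/-- The radius of the covered disc depends only on `m`, which makes the open mapping theorem stable
under perturbation of `ψ`. -/
theorem ball_subset_image_closedBall_of_le_norm_sub {ψ : ℂ → ℂ} {U : Set ℂ} (hU : IsOpen U)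
    (hUc : IsPreconnected U) (hψ : DifferentiableOn ℂ ψ U) {z₀ : ℂ} {r m : ℝ} (hr : 0 < r)
    (hrU : Metric.closedBall z₀ r ⊆ U) (hm : 0 < m)
    (h : ∀ z ∈ Metric.sphere z₀ r, m ≤ ‖ψ z - ψ z₀‖) :
    Metric.ball (ψ z₀) (m / 2) ⊆ ψ '' Metric.closedBall z₀ r := by
  refine DiffContOnCl.ball_subset_image_closedBall ?_ hr h ?_
  · refine DifferentiableOn.diffContOnCl (hψ.mono ?_)
    rwa [closure_ball _ hr.ne']
  · intro hcon
    simp only [not_not] at hcon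
    -- Local constancy would spread to `U` by the identity theorem and contradict `0 < m` on the
    -- sphere.
    have h1 : Set.EqOn ψ (fun _ => ψ z₀) U :=
      (hψ.analyticOnNhd hU).eqOn_of_preconnected_of_eventuallyEq analyticOnNhd_const hUc
        (hrU (Metric.mem_closedBall_self hr.le)) hcon
    have h2 : z₀ + r ∈ Metric.sphere z₀ r := by simp [abs_of_pos hr]
    have h3 := h _ h2
    rw [h1 (hrU (Metric.sphere_subset_closedBall h2))] at h3
    simp at h3
    linarith

/-- Zeros of the nonconstant function `φ - φ z₀` are isolated, so a small sphere avoids them, and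
compactness gives the lower bound. -/
theorem exists_closedBall_forall_sphere_ne {φ : ℂ → ℂ} {U : Set ℂ} (hU : IsOpen U)
    (hUc : IsPreconnected U) (hφ : DifferentiableOn ℂ φ U) {z₀ z₁ : ℂ} (hz₀ : z₀ ∈ U) (hz₁ : z₁ ∈ U)
    (hne : φ z₁ ≠ φ z₀) :
    ∃ r > 0, ∃ m > 0, Metric.closedBall z₀ r ⊆ U ∧
      ∀ z ∈ Metric.sphere z₀ r, m ≤ ‖φ z - φ z₀‖ := by
  have han := hφ.analyticOnNhd hU
  rcases (han z₀ hz₀).eventually_eq_or_eventually_ne (analyticAt_const (v := φ z₀)) with h | h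
  · exact absurd (han.eqOn_of_preconnected_of_eventuallyEq analyticOnNhd_const hUc hz₀ h hz₁) hne
  · rw [eventually_nhdsWithin_iff, Metric.eventually_nhds_iff_ball] at h
    obtain ⟨ε, hε, h⟩ := h
    obtain ⟨ε', hε', h'⟩ := Metric.isOpen_iff.1 hU z₀ hz₀
    have hr : 0 < min ε ε' / 2 := by positivity
    have hsub : Metric.closedBall z₀ (min ε ε' / 2) ⊆ U :=
      (Metric.closedBall_subset_ball (by linarith [min_le_right ε ε', lt_min hε hε'])).trans h'
    have hcont : ContinuousOn (fun z => ‖φ z - φ z₀‖) (Metric.sphere z₀ (min ε ε' / 2)) :=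
      ((hφ.continuousOn.mono (Metric.sphere_subset_closedBall.trans hsub)).sub
        continuousOn_const).norm
    obtain ⟨x, hx, hmin⟩ := (isCompact_sphere z₀ (min ε ε' / 2)).exists_isMinOn
      (NormedSpace.sphere_nonempty.2 hr.le) hcont
    refine ⟨_, hr, ‖φ x - φ z₀‖, ?_, hsub, fun z hz => hmin hz⟩
    rw [gt_iff_lt, norm_pos_iff, sub_ne_zero]
    refine h x ?_ (Metric.ne_of_mem_sphere hx hr.ne')
    rw [Metric.mem_sphere] at hx
    rw [Metric.mem_ball, hx]
    linarith [min_le_left ε ε', lt_min hε hε']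

/-! ### The class `Ã(D)` -/

namespace ExtendedDiscAlgebra

theorem continuous_coe (f : ExtendedDiscAlgebra) : Continuous f := f.1.continuous

theorem continuous_eval : Continuous fun p : ExtendedDiscAlgebra × ClosedDisc => p.1 p.2 := by
  have h : Continuous fun f : ExtendedDiscAlgebra => f.1 := continuous_subtype_val
  have : Continuous fun p : ExtendedDiscAlgebra × ClosedDisc => p.1.1 p.2 :=
    (h.comp continuous_fst).eval continuous_snd
  exact this

/-- The finite part of a member of `Ã(D)`, as a function on the plane. -/
noncomputable def finitePart (f : ExtendedDiscAlgebra) (z : ℂ) : ℂ :=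
  (f (ClosedDisc.clamp z)).toComplex

/-- A single finite value excludes the alternative $f\equiv\infty$. -/
theorem ne_infty_of_norm_lt {f : ExtendedDiscAlgebra} {w : ClosedDisc}
    (hw : f w ≠ ExtendedPlane.infty) {z : ClosedDisc} (hz : ‖(z : ℂ)‖ < 1) :
    f z ≠ ExtendedPlane.infty := by
  rcases f.2 with h | ⟨g, -, h⟩
  · exact absurd (h w) hw
  · rw [show f z = ExtendedPlane.ofComplex (g z) from h z hz]
    exact ExtendedPlane.ofComplex_ne_infty _

theorem ofComplex_finitePart {f : ExtendedDiscAlgebra} {w : ClosedDisc}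
    (hw : f w ≠ ExtendedPlane.infty) {z : ClosedDisc} (hz : ‖(z : ℂ)‖ < 1) :
    ExtendedPlane.ofComplex (f.finitePart z) = f z := by
  rw [finitePart, ClosedDisc.clamp_coe, ExtendedPlane.ofComplex_toComplex (ne_infty_of_norm_lt hw hz)]

theorem differentiableOn_finitePart {f : ExtendedDiscAlgebra} {w : ClosedDisc}
    (hw : f w ≠ ExtendedPlane.infty) : DifferentiableOn ℂ f.finitePart (Metric.ball 0 1) := by
  rcases f.2 with h | ⟨g, hg, h⟩
  · exact absurd (h w) hw
  · refine hg.congr fun z hz => ?_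
    rw [mem_ball_zero_iff] at hz
    have h1 := h (ClosedDisc.clamp z) (by rwa [ClosedDisc.coe_clamp hz.le])
    rw [ClosedDisc.coe_clamp hz.le] at h1
    rw [finitePart, show f (ClosedDisc.clamp z) = ExtendedPlane.ofComplex (g z) from h1,
      ExtendedPlane.toComplex_ofComplex]

theorem eventually_dist_toComplex_lt {f : ExtendedDiscAlgebra} {z : ClosedDisc}
    (hz : f z ≠ ExtendedPlane.infty) {a : ℂ} (ha : (f z).toComplex = a) {η : ℝ} (hη : 0 < η) :
    ∀ᶠ p : ExtendedDiscAlgebra × ClosedDisc in 𝓝 (f, z),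
      p.1 p.2 ≠ ExtendedPlane.infty ∧ dist (p.1 p.2).toComplex a < η := by
  have h1 : Filter.Tendsto (fun p : ExtendedDiscAlgebra × ClosedDisc => p.1 p.2) (𝓝 (f, z))
      (𝓝 (f z)) := continuous_eval.tendsto (f, z)
  refine (h1.eventually (isOpen_ne.mem_nhds hz)).and ?_
  have h2 := (ExtendedPlane.continuousAt_toComplex hz).tendsto.comp h1
  rw [ha] at h2
  exact h2.eventually (Metric.ball_mem_nhds a hη)

/-- If a nonconstant `f` takes at `ζ` a value which it takes in the open disc, then so do the
functions near `f` at the points near `ζ`. -/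
theorem eventually_mem_image {f : ExtendedDiscAlgebra} (hf : ∃ z w, f z ≠ f w) {ζ : ClosedDisc}
    (hζ : f ζ ∈ f '' {z : ClosedDisc | ‖(z : ℂ)‖ < 1}) :
    ∀ᶠ p : ExtendedDiscAlgebra × ClosedDisc in 𝓝 (f, ζ),
      p.1 p.2 ∈ p.1 '' {z : ClosedDisc | ‖(z : ℂ)‖ < 1} := by
  obtain ⟨w, hw⟩ : ∃ w, f w ≠ ExtendedPlane.infty := by
    by_contra! hcon
    obtain ⟨z, w, hzw⟩ := hf
    exact hzw ((hcon z).trans (hcon w).symm)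
  obtain ⟨z₀, hz₀ : ‖(z₀ : ℂ)‖ < 1, hfz₀⟩ := hζ
  have hφ := differentiableOn_finitePart hw
  obtain ⟨z₁, hz₁, hne⟩ : ∃ z₁ : ClosedDisc, ‖(z₁ : ℂ)‖ < 1 ∧ f z₁ ≠ f z₀ := by
    by_contra! hcon
    have := ClosedDisc.eq_const_of_eq_const_of_norm_lt f.continuous_coe hcon
    obtain ⟨z, w, hzw⟩ := hf
    exact hzw ((this z).trans (this w).symm)
  have hne' : f.finitePart z₁ ≠ f.finitePart z₀ := fun h => hne <| by
    rw [← ofComplex_finitePart hw hz₁, h, ofComplex_finitePart hw hz₀]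
  have hUc : IsPreconnected (Metric.ball (0 : ℂ) 1) := (convex_ball _ _).isPreconnected
  obtain ⟨r, hr, m, hm, hsub, hsphere⟩ := exists_closedBall_forall_sphere_ne Metric.isOpen_ball hUc hφ
    (mem_ball_zero_iff.2 hz₀) (mem_ball_zero_iff.2 hz₁) hne'
  -- Compactness makes the closeness of `g` to `f` uniform on the disc; at each centre `z` it is
  -- split as `m / 16 + m / 16` through the value of `f` at `z`.
  have hball : ∀ᶠ g : ExtendedDiscAlgebra in 𝓝 f, ∀ z ∈ Metric.closedBall (z₀ : ℂ) r,
      g (ClosedDisc.clamp z) ≠ ExtendedPlane.infty ∧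
        dist (g.finitePart z) (f.finitePart z) < m / 8 := by
    refine (isCompact_closedBall (z₀ : ℂ) r).eventually_forall_of_forall_eventually
      (P := fun (g : ExtendedDiscAlgebra) (z : ℂ) => g (ClosedDisc.clamp z) ≠ ExtendedPlane.infty ∧
        dist (g.finitePart z) (f.finitePart z) < m / 8) fun z hz => ?_
    have hz1 := mem_ball_zero_iff.1 (hsub hz)
    have hz2 : ‖(ClosedDisc.clamp z : ℂ)‖ < 1 := by rwa [ClosedDisc.coe_clamp hz1.le]
    have hev := eventually_dist_toComplex_lt (ne_infty_of_norm_lt hw hz2) rfl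
      (show 0 < m / 16 by positivity)
    have ht : Filter.Tendsto (fun p : ExtendedDiscAlgebra × ℂ => (p.1, ClosedDisc.clamp p.2))
        (𝓝 (f, z)) (𝓝 (f, ClosedDisc.clamp z)) :=
      (continuous_fst.prodMk (ClosedDisc.continuous_clamp.comp continuous_snd)).tendsto (f, z)
    have ht' : Filter.Tendsto (fun p : ExtendedDiscAlgebra × ℂ => (f, ClosedDisc.clamp p.2))
        (𝓝 (f, z)) (𝓝 (f, ClosedDisc.clamp z)) :=
      (continuous_const.prodMk (ClosedDisc.continuous_clamp.comp continuous_snd)).tendsto (f, z)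
    filter_upwards [ht.eventually hev, ht'.eventually hev] with p h1 h2
    refine ⟨h1.1, (dist_triangle_right _ _ _).trans_lt ((add_lt_add h1.2 h2.2).trans_le ?_)⟩
    linarith
  have hfζ : f ζ ≠ ExtendedPlane.infty := hfz₀ ▸ ne_infty_of_norm_lt hw hz₀
  have hval : (f ζ).toComplex = f.finitePart z₀ := by
    rw [← hfz₀, finitePart, ClosedDisc.clamp_coe]
  filter_upwards [eventually_dist_toComplex_lt hfζ hval (show 0 < m / 8 by positivity),
    continuous_fst.tendsto (f, ζ) |>.eventually hball]
  rintro ⟨g, ζ'⟩ ⟨h1, h2⟩ h3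
  dsimp only at h1 h2 h3 ⊢
  have hz₀mem : (z₀ : ℂ) ∈ Metric.closedBall (z₀ : ℂ) r := Metric.mem_closedBall_self hr.le
  -- On the sphere `g` keeps the lower bound `m - 2 * (m / 8) ≥ m / 2`, so it covers radius `m / 4`
  -- about its value at `z₀`; its value at `ζ'` is within `m / 8 + m / 8` of that value.
  obtain ⟨v, hv, hgv⟩ := ball_subset_image_closedBall_of_le_norm_sub Metric.isOpen_ball hUc
    (differentiableOn_finitePart h1) hr hsub (m := m / 2) (by positivity) (fun z hz => by
      have h4 := (h3 z (Metric.sphere_subset_closedBall hz)).2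
      have h5 := (h3 z₀ hz₀mem).2
      have h6 := hsphere z hz
      rw [← dist_eq_norm] at h6 ⊢
      have h7 := dist_triangle4 (f.finitePart z) (g.finitePart z) (g.finitePart z₀) (f.finitePart z₀)
      rw [dist_comm] at h4
      linarith) (show (g ζ').toComplex ∈ Metric.ball (g.finitePart z₀) (m / 2 / 2) by
        have h5 := (h3 z₀ hz₀mem).2
        rw [Metric.mem_ball]
        have := dist_triangle_right (g ζ').toComplex (g.finitePart z₀) (f.finitePart z₀)
        linarith)
  have hv1 := mem_ball_zero_iff.1 (hsub hv)
  refine ⟨ClosedDisc.clamp v, by rwa [Set.mem_ofPred_eq, ClosedDisc.coe_clamp hv1.le], ?_⟩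
  rw [← ExtendedPlane.ofComplex_toComplex h1, ← hgv, finitePart,
    ExtendedPlane.ofComplex_toComplex (h3 v hv).1]

/-- Nonconstancy is part of the set because the open mapping argument says nothing near a constant.
-/
theorem isOpen_setOf_exceptionalSet_subset {U : Set ℂ} (hU : IsOpen U) :
    IsOpen {f : ExtendedDiscAlgebra | (∃ z w, f z ≠ f w) ∧ f.exceptionalSet ⊆ U} := by
  rw [isOpen_iff_mem_nhds]
  rintro f ⟨⟨z, w, hzw⟩, hfU⟩
  have hev (z : ClosedDisc) : Continuous fun f : ExtendedDiscAlgebra => f z :=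
    continuous_eval.comp (continuous_id.prodMk continuous_const)
  have h1 : ∀ᶠ g : ExtendedDiscAlgebra in 𝓝 f, g z ≠ g w :=
    (isOpen_ne_fun (hev z) (hev w)).mem_nhds hzw
  have hK : IsCompact {ζ : ClosedDisc | ‖(ζ : ℂ)‖ = 1 ∧ (ζ : ℂ) ∉ U} := by
    refine IsClosed.isCompact ?_
    exact (isClosed_eq (by fun_prop) continuous_const).inter
      (hU.isClosed_compl.preimage continuous_subtype_val)
  have h2 := hK.eventually_forall_of_forall_eventually
    (P := fun (g : ExtendedDiscAlgebra) ζ => g ζ ∈ g '' {z : ClosedDisc | ‖(z : ℂ)‖ < 1})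
    (x₀ := f) fun ζ hζ => by
      refine eventually_mem_image ⟨z, w, hzw⟩ ?_
      by_contra hcon
      exact hζ.2 (hfU ⟨ζ, ⟨hζ.1, hcon⟩, rfl⟩)
  filter_upwards [h1, h2] with g hg1 hg2
  refine ⟨⟨z, w, hg1⟩, ?_⟩
  rintro _ ⟨ζ, ⟨hζ1, hζ2⟩, rfl⟩
  by_contra hcon
  exact hζ2 (hg2 ζ ⟨hζ1, hcon⟩)

theorem isOpen_setOf_hausdorffPremeasure_lt (h : ℝ≥0 → ℝ≥0) (δ : ℝ≥0) (a : ℝ≥0∞) :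
    IsOpen {f : ExtendedDiscAlgebra | (∃ z w, f z ≠ f w) ∧
      hausdorffPremeasure h δ f.exceptionalSet < a} := by
  have : {f : ExtendedDiscAlgebra | (∃ z w, f z ≠ f w) ∧
      hausdorffPremeasure h δ f.exceptionalSet < a} =
      ⋃ (c : ℕ → ℂ) (r : ℕ → ℝ≥0) (_ : (∀ n, r n ≤ δ) ∧ ∑' n, (h (r n) : ℝ≥0∞) < a),
        {f : ExtendedDiscAlgebra | (∃ z w, f z ≠ f w) ∧
          f.exceptionalSet ⊆ ⋃ n, Metric.ball (c n) (r n)} := by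
    ext f
    simp only [hausdorffPremeasure_lt_iff, Set.mem_iUnion, Set.mem_ofPred_eq, exists_prop]
    tauto
  rw [this]
  exact isOpen_iUnion fun c => isOpen_iUnion fun r => isOpen_iUnion fun _ =>
    isOpen_setOf_exceptionalSet_subset (isOpen_iUnion fun _ => Metric.isOpen_ball)

theorem exceptionalSet_eq_empty {f : ExtendedDiscAlgebra} (hf : ∀ z w, f z = f w) :
    f.exceptionalSet = ∅ := by
  rw [exceptionalSet, Set.image_eq_empty, Set.eq_empty_iff_forall_notMem]
  rintro ζ ⟨-, h⟩
  exact h ⟨ClosedDisc.clamp 0, by simp [ClosedDisc.coe_clamp], hf _ _⟩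

theorem isClosed_setOf_const : IsClosed {f : ExtendedDiscAlgebra | ∀ z w, f z = f w} := by
  have hev (z : ClosedDisc) : Continuous fun f : ExtendedDiscAlgebra => f z :=
    continuous_eval.comp (continuous_id.prodMk continuous_const)
  simp only [Set.ofPred_forall]
  exact isClosed_iInter fun z => isClosed_iInter fun w => isClosed_eq (hev z) (hev w)

theorem setOf_hausdorffLambda_eq_zero {h : ℝ≥0 → ℝ≥0} (h0 : h 0 = 0) :
    {f : ExtendedDiscAlgebra | hausdorffLambda h f.exceptionalSet = 0} =
      {f | ∀ z w, f z = f w} ∪ ⋂ n : ℕ, {f | (∃ z w, f z ≠ f w) ∧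
        hausdorffPremeasure h ((n + 1 : ℝ≥0)⁻¹) f.exceptionalSet < ((n + 1 : ℝ≥0)⁻¹ : ℝ≥0)} := by
  ext f
  simp only [Set.mem_ofPred_eq, Set.mem_union, Set.mem_iInter]
  by_cases hf : ∀ z w, f z = f w
  · refine iff_of_true ?_ (Or.inl hf)
    rw [exceptionalSet_eq_empty hf, hausdorffLambda_empty h0]
  · have hf' : ∃ z w, f z ≠ f w := by simpa using hf
    simp only [hausdorffLambda_eq_zero_iff, hf, hf', true_and, false_or]

theorem isGδ_setOf_hausdorffLambda_eq_zero {h : ℝ≥0 → ℝ≥0} (h0 : h 0 = 0) :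
    IsGδ {f : ExtendedDiscAlgebra | hausdorffLambda h f.exceptionalSet = 0} := by
  rw [setOf_hausdorffLambda_eq_zero h0]
  exact isClosed_setOf_const.isGδ.union
    (IsGδ.iInter_of_isOpen fun n => isOpen_setOf_hausdorffPremeasure_lt _ _ _)

end ExtendedDiscAlgebra

/-! ### The disc algebra -/

/-- The disc algebra, as a set of continuous functions on the closed disc. -/
def discAlgebra : Set C(ClosedDisc, ℂ) :=
  {F | DifferentiableOn ℂ (fun z => F (ClosedDisc.clamp z)) (Metric.ball 0 1)}

/-- Weierstrass's theorem on uniform limits; it provides the completeness needed for Baire's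
theorem. -/
theorem isClosed_discAlgebra : IsClosed discAlgebra := by
  refine IsSeqClosed.isClosed fun F G hF hG => ?_
  have h1 := ContinuousMap.tendsto_iff_tendstoUniformly.1 hG
  exact (h1.comp ClosedDisc.clamp).tendstoUniformlyOn.tendstoLocallyUniformlyOn.differentiableOn
    (.of_forall hF) Metric.isOpen_ball

theorem mem_discAlgebra_of_forall_eq {F : C(ClosedDisc, ℂ)} {g : ℂ → ℂ}
    (hg : DifferentiableOn ℂ g (Metric.ball 0 1))
    (h : ∀ z : ClosedDisc, ‖(z : ℂ)‖ < 1 → F z = g z) : F ∈ discAlgebra := by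
  refine hg.congr fun z hz => ?_
  rw [mem_ball_zero_iff] at hz
  have h1 := h (ClosedDisc.clamp z)
  rw [ClosedDisc.coe_clamp hz.le] at h1
  exact h1 hz

namespace ExtendedDiscAlgebra

/-- The inclusion of the disc algebra in `Ã(D)`. -/
noncomputable def ofDiscAlgebra (F : discAlgebra) : ExtendedDiscAlgebra :=
  ⟨⟨fun z => ExtendedPlane.ofComplex (F.1 z),
    ExtendedPlane.continuous_ofComplex.comp F.1.continuous⟩,
    Or.inr ⟨fun z => F.1 (ClosedDisc.clamp z), F.2, fun z _ => by
      change _ = ExtendedPlane.ofComplex (F.1 (ClosedDisc.clamp z))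
      rw [ClosedDisc.clamp_coe]
      rfl⟩⟩

theorem ofDiscAlgebra_apply (F : discAlgebra) (z : ClosedDisc) :
    ofDiscAlgebra F z = ExtendedPlane.ofComplex (F.1 z) := rfl

theorem dist_le_iff {f g : ExtendedDiscAlgebra} {C : ℝ} (hC : 0 ≤ C) :
    dist f g ≤ C ↔ ∀ z, dist (f z) (g z) ≤ C :=
  ContinuousMap.dist_le (f := f.1) (g := g.1) hC

theorem continuous_ofDiscAlgebra : Continuous ofDiscAlgebra := by
  refine LipschitzWith.continuous (K := 1) (LipschitzWith.of_dist_le_mul fun F G => ?_)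
  rw [NNReal.coe_one, one_mul, dist_le_iff dist_nonneg]
  intro z
  exact (ExtendedPlane.dist_ofComplex_le _ _).trans (ContinuousMap.dist_apply_le_dist z)

theorem exceptionalSet_ofDiscAlgebra_subset {F : discAlgebra} {U : Set ℂ}
    (h : ∀ ζ : ClosedDisc, ‖(ζ : ℂ)‖ = 1 → (ζ : ℂ) ∉ U →
      ∃ z : ClosedDisc, ‖(z : ℂ)‖ < 1 ∧ F.1 z = F.1 ζ) :
    (ofDiscAlgebra F).exceptionalSet ⊆ U := by
  rintro _ ⟨ζ, ⟨hζ1, hζ2⟩, rfl⟩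
  by_contra hcon
  obtain ⟨z, hz, hzζ⟩ := h ζ hζ1 hcon
  exact hζ2 ⟨z, hz, by rw [ofDiscAlgebra_apply, ofDiscAlgebra_apply, hzζ]⟩

/-- Large constants approximate $\infty$; any other `f` is approximated by its dilations $f(rz)$
with $r<1$, which are finite on the circle too. -/
theorem denseRange_ofDiscAlgebra : DenseRange ofDiscAlgebra := by
  refine Metric.denseRange_iff.2 fun f ε hε => ?_
  rcases f.2 with h | ⟨g, hg, h⟩
  · obtain ⟨n, hn⟩ := exists_nat_one_div_lt hε
    refine ⟨⟨ContinuousMap.const _ ((n + 1 : ℝ) : ℂ), differentiableOn_const _⟩, ?_⟩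
    refine lt_of_le_of_lt ?_ hn
    rw [dist_le_iff (by positivity)]
    intro z
    rw [show f z = ExtendedPlane.infty from h z, dist_comm]
    refine ExtendedPlane.dist_ofComplex_infty_le ?_
    change ‖((n + 1 : ℝ) : ℂ)‖ = _
    rw [Complex.norm_real, Real.norm_eq_abs, abs_of_pos (by positivity)]
  · have huc := CompactSpace.uniformContinuous_of_continuous f.continuous_coe
    obtain ⟨δ, hδ, huc⟩ := Metric.uniformContinuous_iff.1 huc (ε / 2) (by positivity)
    obtain ⟨r, hr0, hr1, hrδ⟩ : ∃ r : ℝ, 0 < r ∧ r < 1 ∧ 1 - r < δ := by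
      refine ⟨max (1 / 2) (1 - δ / 2), by positivity, max_lt (by norm_num) (by linarith), ?_⟩
      linarith [le_max_right (1 / 2) (1 - δ / 2)]
    have hnorm {z : ℂ} (hz : ‖z‖ ≤ 1) : ‖(r : ℂ) * z‖ < 1 := by
      rw [norm_mul, Complex.norm_real, Real.norm_eq_abs, abs_of_pos hr0]
      nlinarith [norm_nonneg z]
    have hmaps : Set.MapsTo (fun z : ℂ => (r : ℂ) * z) (Metric.closedBall 0 1)
        (Metric.ball 0 1) := fun z hz =>
      mem_ball_zero_iff.2 (hnorm (mem_closedBall_zero_iff.1 hz))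
    have hcont : Continuous fun z : ClosedDisc => g (r * z) :=
      hg.continuousOn.comp_continuous (by fun_prop) fun z => hmaps z.2
    refine ⟨⟨⟨_, hcont⟩, mem_discAlgebra_of_forall_eq (g := fun z => g (r * z)) ?_ fun _ _ => rfl⟩, ?_⟩
    · exact hg.comp (by fun_prop) (hmaps.mono_left Metric.ball_subset_closedBall)
    · refine lt_of_le_of_lt ?_ (half_lt_self hε)
      rw [dist_le_iff (by positivity)]
      intro z
      have hz := ClosedDisc.norm_coe_le z
      have h1 := h (ClosedDisc.clamp (r * z)) (by
        rw [ClosedDisc.coe_clamp (hnorm hz).le]; exact hnorm hz)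
      rw [ClosedDisc.coe_clamp (hnorm hz).le] at h1
      have h2 : ofDiscAlgebra ⟨⟨_, hcont⟩, mem_discAlgebra_of_forall_eq
          (g := fun z => g (r * z)) (hg.comp (by fun_prop)
            (hmaps.mono_left Metric.ball_subset_closedBall)) fun _ _ => rfl⟩ z =
          f (ClosedDisc.clamp (r * z)) := h1.symm
      rw [h2]
      refine (huc ?_).le
      rw [Subtype.dist_eq, ClosedDisc.coe_clamp (hnorm hz).le, dist_eq_norm,
        show (z : ℂ) - r * z = ((1 - r : ℝ) : ℂ) * z by push_cast; ring, norm_mul,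
        Complex.norm_real, Real.norm_eq_abs, abs_of_pos (by linarith)]
      nlinarith [norm_nonneg (z : ℂ)]

end ExtendedDiscAlgebra

/-! ### Functions concentrated near finitely many points of the circle -/

/-- A rational function which decays at `∞` and has a simple zero at `3`. -/
noncomputable def decay (s : ℂ) : ℂ := (s - 3) / s ^ 2

theorem norm_decay_le {s : ℂ} (hs : 1 ≤ ‖s‖) : ‖decay s‖ ≤ 4 / ‖s‖ := by
  have h0 : 0 < ‖s‖ := by linarith
  rw [decay, norm_div, norm_pow, div_le_div_iff₀ (by positivity) h0]
  have h1 : ‖s - 3‖ ≤ ‖s‖ + 3 := (norm_sub_le _ _).trans (by simp)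
  nlinarith [mul_le_mul_of_nonneg_right h1 h0.le]

theorem le_norm_decay {s : ℂ} (hs : ‖s - 3‖ = 1) : 1 / 16 ≤ ‖decay s‖ := by
  have h1 : ‖s‖ ≤ 4 := by
    have := norm_add_le (s - 3) 3
    simp only [sub_add_cancel, hs, Complex.norm_ofNat] at this
    linarith
  have h2 : 2 ≤ ‖s‖ := by
    have := norm_sub_norm_le (3 : ℂ) s
    rw [norm_sub_rev, hs, Complex.norm_ofNat] at this
    linarith
  rw [decay, norm_div, norm_pow, hs]
  exact one_div_le_one_div_of_le (by positivity) (by nlinarith)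

theorem decay_three : decay 3 = 0 := by simp [decay]

/-- The coordinate at scale `δ` near the point `ζ` of the circle. -/
noncomputable def scaledCoord (δ : ℝ) (ζ z : ℂ) : ℂ := (1 + δ - z * starRingEnd ℂ ζ) / δ

/-- The point with a given coordinate at scale `δ` near the point `ζ` of the circle. -/
noncomputable def ofScaledCoord (δ : ℝ) (ζ s : ℂ) : ℂ := ζ * (1 - δ * (s - 1))

section scaledCoord

variable {δ : ℝ} {ζ : ℂ}

theorem scaledCoord_ofScaledCoord (hδ : 0 < δ) (hζ : ‖ζ‖ = 1) (s : ℂ) :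
    scaledCoord δ ζ (ofScaledCoord δ ζ s) = s := by
  have h1 : ζ * starRingEnd ℂ ζ = 1 := by
    rw [Complex.mul_conj, Complex.normSq_eq_norm_sq, hζ]; simp
  have h2 : (δ : ℂ) ≠ 0 := by exact_mod_cast hδ.ne'
  rw [scaledCoord, ofScaledCoord, show ζ * (1 - δ * (s - 1)) * starRingEnd ℂ ζ =
    (ζ * starRingEnd ℂ ζ) * (1 - δ * (s - 1)) by ring, h1]
  field_simp
  ring

theorem norm_ofScaledCoord_sub (hδ : 0 < δ) (hζ : ‖ζ‖ = 1) (s : ℂ) :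
    ‖ofScaledCoord δ ζ s - ζ‖ = δ * ‖s - 1‖ := by
  rw [ofScaledCoord, show ζ * (1 - δ * (s - 1)) - ζ = -(ζ * (δ * (s - 1))) by ring, norm_neg,
    norm_mul, norm_mul, hζ, one_mul, Complex.norm_real, Real.norm_eq_abs, abs_of_pos hδ]

/-- With $u=s-1$, the claim is $\delta|u|^2<2\operatorname{Re}u$. The disc $|u-2|<3/2$ lies in
$|u-2|<2$, where $|u|^2<4\operatorname{Re}u$, and $4\delta<2$. -/
theorem norm_ofScaledCoord_lt_one (hδ : 0 < δ) (hδ' : δ ≤ 1 / 20) (hζ : ‖ζ‖ = 1) {s : ℂ}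
    (hs : ‖s - 3‖ < 3 / 2) : ‖ofScaledCoord δ ζ s‖ < 1 := by
  rw [ofScaledCoord, norm_mul, hζ, one_mul, ← sq_lt_one_iff₀ (norm_nonneg _), Complex.sq_norm,
    Complex.normSq_apply]
  have h1 : ‖s - 3‖ ^ 2 < (3 / 2) ^ 2 := by gcongr
  rw [Complex.sq_norm, Complex.normSq_apply] at h1
  simp only [Complex.sub_re, Complex.sub_im, Complex.one_re, Complex.one_im, Complex.re_ofReal_mul,
    Complex.im_ofReal_mul, Complex.re_ofNat, Complex.im_ofNat] at h1 ⊢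
  have hx : 0 < s.re - 1 := by nlinarith [mul_self_nonneg (s.re - 3), mul_self_nonneg s.im]
  have h2 : δ * ((s.re - 1) ^ 2 + s.im ^ 2) < 2 * (s.re - 1) := by
    have h3 : (s.re - 1) ^ 2 + s.im ^ 2 ≤ 4 * (s.re - 1) := by nlinarith
    nlinarith
  nlinarith [mul_lt_mul_of_pos_left h2 hδ]

theorem mul_norm_scaledCoord (hδ : 0 < δ) (z : ℂ) :
    δ * ‖scaledCoord δ ζ z‖ = ‖1 + δ - z * starRingEnd ℂ ζ‖ := by
  rw [scaledCoord, norm_div, Complex.norm_real, Real.norm_eq_abs, abs_of_pos hδ]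
  field_simp

/-- The pole $s=0$ of `decay` corresponds to $z=(1+\delta)\zeta$, outside the closed disc. -/
theorem one_le_norm_scaledCoord (hδ : 0 < δ) (hζ : ‖ζ‖ = 1) {z : ℂ} (hz : ‖z‖ ≤ 1) :
    1 ≤ ‖scaledCoord δ ζ z‖ := by
  have h1 := mul_norm_scaledCoord (ζ := ζ) hδ z
  have h2 := norm_sub_norm_le (1 + δ : ℂ) (z * starRingEnd ℂ ζ)
  rw [norm_mul, RCLike.norm_conj, hζ, mul_one, show (1 + δ : ℂ) = ((1 + δ : ℝ) : ℂ) by push_cast; rfl,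
    Complex.norm_real, Real.norm_eq_abs, abs_of_pos (by linarith)] at h2
  push_cast at h2
  nlinarith

theorem le_norm_scaledCoord (hδ : 0 < δ) (hζ : ‖ζ‖ = 1) (z : ℂ) :
    (‖z - ζ‖ - δ) / δ ≤ ‖scaledCoord δ ζ z‖ := by
  have h0 : ζ * starRingEnd ℂ ζ = 1 := by
    rw [Complex.mul_conj, Complex.normSq_eq_norm_sq, hζ]; simp
  rw [div_le_iff₀ hδ, mul_comm, mul_norm_scaledCoord hδ]
  have h1 : ‖z - ζ‖ = ‖(1 + δ - z * starRingEnd ℂ ζ) - δ‖ := by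
    rw [show (1 + δ - z * starRingEnd ℂ ζ) - δ = -((z - ζ) * starRingEnd ℂ ζ) by
      rw [sub_mul, h0]; ring, norm_neg, norm_mul, RCLike.norm_conj, hζ, mul_one]
  have h2 := norm_sub_le (1 + δ - z * starRingEnd ℂ ζ) (δ : ℂ)
  rw [Complex.norm_real, Real.norm_eq_abs, abs_of_pos hδ] at h2
  linarith

theorem norm_decay_scaledCoord_le (hδ : 0 < δ) (hζ : ‖ζ‖ = 1) {z : ℂ} (hz : ‖z‖ ≤ 1) :
    ‖decay (scaledCoord δ ζ z)‖ ≤ 4 := by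
  have h := one_le_norm_scaledCoord hδ hζ hz
  exact (norm_decay_le h).trans (div_le_self (by norm_num) h)

theorem norm_decay_scaledCoord_le_of_le (hδ : 0 < δ) (hζ : ‖ζ‖ = 1) {z : ℂ} (hz : ‖z‖ ≤ 1) {ρ : ℝ}
    (hρ : 2 * δ ≤ ρ) (hzζ : ρ ≤ ‖z - ζ‖) : ‖decay (scaledCoord δ ζ z)‖ ≤ 8 * δ / ρ := by
  refine (norm_decay_le (one_le_norm_scaledCoord hδ hζ hz)).trans ?_
  have h1 : ρ / 2 / δ ≤ ‖scaledCoord δ ζ z‖ :=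
    le_trans (by gcongr; linarith) (le_norm_scaledCoord hδ hζ z)
  have h2 : 0 < ρ := by linarith
  refine (div_le_div_of_nonneg_left (by norm_num) (by positivity) h1).trans (le_of_eq ?_)
  field_simp
  norm_num

theorem differentiableAt_decay_scaledCoord (hδ : 0 < δ) (hζ : ‖ζ‖ = 1) {z : ℂ} (hz : ‖z‖ ≤ 1) :
    DifferentiableAt ℂ (fun z => decay (scaledCoord δ ζ z)) z := by
  have h1 : scaledCoord δ ζ z ≠ 0 := norm_pos_iff.1
    (lt_of_lt_of_le one_pos (one_le_norm_scaledCoord hδ hζ hz))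
  have h2 : DifferentiableAt ℂ (scaledCoord δ ζ) z := by
    unfold scaledCoord
    fun_prop
  unfold decay
  exact (h2.sub_const 3).div (h2.pow 2) (pow_ne_zero 2 h1)

end scaledCoord

/-- A sum of functions concentrated at scale `δ` near the points of `t`. -/
noncomputable def decaySum (t : Finset ℂ) (δ : ℝ) (z : ℂ) : ℂ := ∑ ζ ∈ t, decay (scaledCoord δ ζ z)

section decaySum

variable {t : Finset ℂ} {δ ρ : ℝ}

theorem differentiableAt_decaySum (hδ : 0 < δ) (ht : ∀ ζ ∈ t, ‖ζ‖ = 1) {z : ℂ} (hz : ‖z‖ ≤ 1) :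
    DifferentiableAt ℂ (decaySum t δ) z := by
  unfold decaySum
  exact DifferentiableAt.fun_sum fun ζ hζ => differentiableAt_decay_scaledCoord hδ (ht ζ hζ) hz

theorem norm_decaySum_le (hδ : 0 < δ) (ht : ∀ ζ ∈ t, ‖ζ‖ = 1) {z : ℂ} (hz : ‖z‖ ≤ 1)
    (hρ : 2 * δ ≤ ρ) (hfar : ∀ ζ ∈ t, ρ ≤ ‖z - ζ‖) :
    ‖decaySum t δ z‖ ≤ t.card * (8 * δ / ρ) := by
  rw [← nsmul_eq_mul]
  exact (norm_sum_le _ _).trans (Finset.sum_le_card_nsmul _ _ _ fun ζ hζ =>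
    norm_decay_scaledCoord_le_of_le hδ (ht ζ hζ) hz hρ (hfar ζ hζ))

/-- By separation, a point within `ρ` of `ξ` is at distance at least `ρ` from the rest of `t`, so
only the bump at `ξ` matters. -/
theorem norm_decaySum_sub_le (hδ : 0 < δ) (ht : ∀ ζ ∈ t, ‖ζ‖ = 1) {z : ℂ} (hz : ‖z‖ ≤ 1)
    (hρ : 2 * δ ≤ ρ) (hsep : ∀ ζ ∈ t, ∀ ξ ∈ t, ζ ≠ ξ → 2 * ρ ≤ dist ζ ξ) {ξ : ℂ} (hξ : ξ ∈ t)
    (hzξ : ‖z - ξ‖ ≤ ρ) :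
    ‖decaySum t δ z - decay (scaledCoord δ ξ z)‖ ≤ t.card * (8 * δ / ρ) := by
  have h1 : decaySum t δ z - decay (scaledCoord δ ξ z) = decaySum (t.erase ξ) δ z := by
    rw [decaySum, decaySum, ← Finset.add_sum_erase _ _ hξ, add_sub_cancel_left]
  have h2 : 0 ≤ 8 * δ / ρ := div_nonneg (by positivity) (by linarith)
  rw [h1]
  refine (norm_decaySum_le hδ (fun ζ hζ => ht ζ (Finset.mem_of_mem_erase hζ)) hz hρ
    fun ζ hζ => ?_).trans ?_
  · obtain ⟨hne, hζ⟩ := Finset.mem_erase.1 hζ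
    have h3 := hsep ζ hζ ξ hξ hne
    rw [dist_eq_norm] at h3
    have h4 := norm_sub_le_norm_sub_add_norm_sub ζ z ξ
    rw [norm_sub_rev ζ z] at h4
    linarith
  · gcongr
    exact Finset.erase_subset _ _

theorem norm_decaySum_le_add (hδ : 0 < δ) (ht : ∀ ζ ∈ t, ‖ζ‖ = 1) {z : ℂ} (hz : ‖z‖ ≤ 1)
    (hρ : 2 * δ ≤ ρ) (hsep : ∀ ζ ∈ t, ∀ ξ ∈ t, ζ ≠ ξ → 2 * ρ ≤ dist ζ ξ) :
    ‖decaySum t δ z‖ ≤ 4 + t.card * (8 * δ / ρ) := by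
  by_cases h : ∃ ξ ∈ t, ‖z - ξ‖ ≤ ρ
  · obtain ⟨ξ, hξ, hzξ⟩ := h
    have h1 := norm_decaySum_sub_le hδ ht hz hρ hsep hξ hzξ
    have h2 := norm_decay_scaledCoord_le hδ (ht ξ hξ) hz
    have h3 := norm_le_norm_sub_add (decaySum t δ z) (decay (scaledCoord δ ξ z))
    linarith
  · push Not at h
    linarith [norm_decaySum_le hδ ht hz hρ fun ζ hζ => (h ζ hζ).le]

end decaySum

/-! ### Density -/

theorem Set.Finite.exists_pos_le_dist {s : Set ℂ} (hs : s.Finite) :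
    ∃ σ > 0, ∀ x ∈ s, ∀ y ∈ s, x ≠ y → σ ≤ dist x y := by
  obtain ⟨C, hC, h⟩ := hs.relatively_discrete
  refine ⟨(min C 1).toReal, ENNReal.toReal_pos (lt_min hC one_pos).ne'
    (min_lt_of_right_lt ENNReal.one_lt_top).ne, fun x hx y hy hxy => ?_⟩
  refine ENNReal.toReal_le_of_le_ofReal dist_nonneg ?_
  rw [← edist_dist]
  exact (min_le_left _ _).trans (h x hx y hy hxy)

/-- Adding to `F` a suitable sum of functions concentrated near the points of a net `t` of the circle
gives a function whose values at the points of the circle away from `t` are taken in the open disc. -/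
theorem forall_exists_eq_of_add_decaySum {F : ClosedDisc → ℂ} {G : ℂ → ℂ} {t : Finset ℂ}
    {ε δ ρ η : ℝ} (hε : 0 < ε) (hδ : 0 < δ) (hδ' : δ ≤ 1 / 20) (hδρ : 4 * δ ≤ ρ) (hδη : 4 * δ < η)
    (hsmall : t.card * (8 * δ / ρ) ≤ 1 / 1000) (ht : ∀ ζ ∈ t, ‖ζ‖ = 1)
    (hsep : ∀ ζ ∈ t, ∀ ξ ∈ t, ζ ≠ ξ → 2 * ρ ≤ dist ζ ξ)
    (hnet : ∀ z : ℂ, ‖z‖ = 1 → ∃ ζ ∈ t, dist z ζ < η)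
    (hF : ∀ z w : ClosedDisc, dist z w < η → dist (F z) (F w) < ε / 1000)
    (hG : DifferentiableOn ℂ G (Metric.ball 0 1))
    (hGF : ∀ z : ClosedDisc, G z = F z + ε * decaySum t δ z) :
    (∃ z w : ClosedDisc, G z ≠ G w) ∧ ∀ ξ : ClosedDisc, ‖(ξ : ℂ)‖ = 1 →
      (ξ : ℂ) ∉ ⋃ ζ ∈ t, Metric.ball ζ ρ → ∃ z : ClosedDisc, ‖(z : ℂ)‖ < 1 ∧ G z = G ξ := by
  have hnorm (ζ : ℂ) (hζ : ζ ∈ t) {s : ℂ} (hs : ‖s - 3‖ < 3 / 2) :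
      ‖ofScaledCoord δ ζ s‖ < 1 := norm_ofScaledCoord_lt_one hδ hδ' (ht ζ hζ) hs
  -- In the coordinate `s`, the new function is the constant $F(\zeta)$ plus `ε * decay s`, up to `ε
  -- / 1000` from the oscillation of `F` and `ε / 1000` from the other bumps.
  have happrox (ζ : ℂ) (hζ : ζ ∈ t) (s : ℂ) (hs : ‖s - 3‖ ≤ 1) :
      ‖G (ofScaledCoord δ ζ s) - (F (ClosedDisc.clamp ζ) + ε * decay s)‖ ≤ ε / 500 := by
    have h1 := (hnorm ζ hζ (hs.trans_lt (by norm_num))).le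
    have h2 := norm_ofScaledCoord_sub hδ (ht ζ hζ) s
    have h3 : ‖s - 1‖ ≤ 3 := by
      have := norm_add_le (s - 3) 2
      rw [Complex.norm_ofNat, show s - 3 + 2 = s - 1 by ring] at this
      linarith
    have h4 : ‖ofScaledCoord δ ζ s - ζ‖ ≤ 3 * δ := by rw [h2]; nlinarith
    have h5 := norm_decaySum_sub_le hδ ht h1 (by linarith) hsep hζ (by linarith)
    rw [scaledCoord_ofScaledCoord hδ (ht ζ hζ)] at h5
    have h6 := hF (ClosedDisc.clamp (ofScaledCoord δ ζ s)) (ClosedDisc.clamp ζ) (by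
      rw [Subtype.dist_eq, ClosedDisc.coe_clamp h1, ClosedDisc.coe_clamp (ht ζ hζ).le, dist_eq_norm]
      linarith)
    have h7 := hGF (ClosedDisc.clamp (ofScaledCoord δ ζ s))
    rw [ClosedDisc.coe_clamp h1] at h7
    rw [dist_eq_norm] at h6
    rw [h7, show F (ClosedDisc.clamp (ofScaledCoord δ ζ s)) +
        ε * decaySum t δ (ofScaledCoord δ ζ s) - (F (ClosedDisc.clamp ζ) + ε * decay s) =
      (F (ClosedDisc.clamp (ofScaledCoord δ ζ s)) - F (ClosedDisc.clamp ζ)) +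
        ε * (decaySum t δ (ofScaledCoord δ ζ s) - decay s) by ring]
    refine (norm_add_le _ _).trans ?_
    rw [norm_mul, Complex.norm_real, Real.norm_eq_abs, abs_of_pos hε]
    nlinarith [mul_le_mul_of_nonneg_left (h5.trans hsmall) hε.le]
  have hcenter (ζ : ℂ) (hζ : ζ ∈ t) :
      ‖G (ofScaledCoord δ ζ 3) - F (ClosedDisc.clamp ζ)‖ ≤ ε / 500 := by
    simpa [decay_three] using happrox ζ hζ 3 (by simp)
  -- Here `ε / 16 - 2 * (ε / 500) ≥ ε / 20`.
  have hsphere (ζ : ℂ) (hζ : ζ ∈ t) (s : ℂ) (hs : s ∈ Metric.sphere (3 : ℂ) 1) :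
      ε / 20 ≤ ‖G (ofScaledCoord δ ζ s) - G (ofScaledCoord δ ζ 3)‖ := by
    rw [mem_sphere_iff_norm] at hs
    have h1 := happrox ζ hζ s hs.le
    have h2 := hcenter ζ hζ
    have h3 : ε / 16 ≤ ‖ε * decay s‖ := by
      rw [norm_mul, Complex.norm_real, Real.norm_eq_abs, abs_of_pos hε]
      nlinarith [mul_le_mul_of_nonneg_left (le_norm_decay hs) hε.le]
    have h4 := norm_add₃_le (a := (F (ClosedDisc.clamp ζ) + ε * decay s) - G (ofScaledCoord δ ζ s))
      (b := G (ofScaledCoord δ ζ s) - G (ofScaledCoord δ ζ 3))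
      (c := G (ofScaledCoord δ ζ 3) - F (ClosedDisc.clamp ζ))
    rw [norm_sub_rev (F (ClosedDisc.clamp ζ) + ε * decay s),
      show (F (ClosedDisc.clamp ζ) + ε * decay s) - G (ofScaledCoord δ ζ s) +
        (G (ofScaledCoord δ ζ s) - G (ofScaledCoord δ ζ 3)) +
        (G (ofScaledCoord δ ζ 3) - F (ClosedDisc.clamp ζ)) = ε * decay s by ring] at h4
    linarith
  constructor
  · obtain ⟨ζ, hζ, -⟩ := hnet 1 (by simp)
    have h4 : (4 : ℂ) ∈ Metric.sphere (3 : ℂ) 1 := by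
      rw [mem_sphere_iff_norm]; norm_num
    refine ⟨ClosedDisc.clamp (ofScaledCoord δ ζ 4), ClosedDisc.clamp (ofScaledCoord δ ζ 3), ?_⟩
    rw [ClosedDisc.coe_clamp (hnorm ζ hζ (by norm_num)).le,
      ClosedDisc.coe_clamp (hnorm ζ hζ (by norm_num)).le]
    intro hcon
    have := hsphere ζ hζ 4 h4
    rw [hcon, sub_self, norm_zero] at this
    linarith
  · intro ξ hξ hfar
    obtain ⟨ζ, hζ, hξζ⟩ := hnet ξ hξ
    have hmaps : Set.MapsTo (ofScaledCoord δ ζ) (Metric.ball 3 (3 / 2)) (Metric.ball 0 1) :=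
      fun s hs => mem_ball_zero_iff.2 (hnorm ζ hζ (mem_ball_iff_norm.1 hs))
    have hdiff : DifferentiableOn ℂ (fun s => G (ofScaledCoord δ ζ s)) (Metric.ball 3 (3 / 2)) :=
      hG.comp (by unfold ofScaledCoord; fun_prop) hmaps
    -- The errors are `ε / 1000` (bumps), `ε / 1000` (oscillation of `F`) and `ε / 500` (centre),
    -- well below `ε / 40`.
    have hmem : G ξ ∈ Metric.ball (G (ofScaledCoord δ ζ 3)) (ε / 20 / 2) := by
      have h1 : ‖decaySum t δ ξ‖ ≤ t.card * (8 * δ / ρ) :=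
        norm_decaySum_le hδ ht hξ.le (by linarith) fun ζ' hζ' => by
          by_contra! hcon
          exact hfar (Set.mem_iUnion₂.2 ⟨ζ', hζ', mem_ball_iff_norm.2 hcon⟩)
      have h2 := hF ξ (ClosedDisc.clamp ζ) (by
        rwa [Subtype.dist_eq, ClosedDisc.coe_clamp (ht ζ hζ).le])
      have h3 := hcenter ζ hζ
      rw [dist_eq_norm] at h2
      rw [mem_ball_iff_norm, hGF, show F ξ + ε * decaySum t δ ξ - G (ofScaledCoord δ ζ 3) =
        (F ξ - F (ClosedDisc.clamp ζ)) + ε * decaySum t δ ξ -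
          (G (ofScaledCoord δ ζ 3) - F (ClosedDisc.clamp ζ)) by ring]
      have h4 := norm_sub_le ((F ξ - F (ClosedDisc.clamp ζ)) + ε * decaySum t δ ξ)
        (G (ofScaledCoord δ ζ 3) - F (ClosedDisc.clamp ζ))
      have h5 := norm_add_le (F ξ - F (ClosedDisc.clamp ζ)) (ε * decaySum t δ ξ)
      rw [norm_mul, Complex.norm_real, Real.norm_eq_abs, abs_of_pos hε] at h5
      nlinarith [mul_le_mul_of_nonneg_left (h1.trans hsmall) hε.le]
    -- The open mapping theorem is applied in the coordinate `s`, so that all radii are independent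
    -- of `δ`.
    obtain ⟨s, hs, hGs⟩ := ball_subset_image_closedBall_of_le_norm_sub Metric.isOpen_ball
      (convex_ball _ _).isPreconnected hdiff one_pos
      (Metric.closedBall_subset_ball (by norm_num)) (by positivity) (hsphere ζ hζ) hmem
    have hs' := hnorm ζ hζ ((mem_closedBall_iff_norm.1 hs).trans_lt (by norm_num))
    refine ⟨ClosedDisc.clamp (ofScaledCoord δ ζ s), ?_, ?_⟩
    · rwa [ClosedDisc.coe_clamp hs'.le]
    · rw [ClosedDisc.coe_clamp hs'.le]
      exact hGs

theorem exists_nnreal_mul_lt {h : ℝ≥0 → ℝ≥0} (hh : Filter.Tendsto h (𝓝 0) (𝓝 0)) (n : ℕ)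
    {a δ : ℝ≥0} {σ : ℝ} (ha : 0 < a) (hδ : 0 < δ) (hσ : 0 < σ) :
    ∃ ρ : ℝ≥0, 0 < ρ ∧ ρ ≤ δ ∧ (ρ : ℝ) ≤ σ ∧ (n : ℝ≥0) * h ρ < a := by
  have h1 : Filter.Tendsto (fun ρ => (n : ℝ≥0) * h ρ) (𝓝 0) (𝓝 0) := by
    simpa using hh.const_mul (n : ℝ≥0)
  have h2 : ∀ᶠ ρ : ℝ≥0 in 𝓝[>] 0, (n : ℝ≥0) * h ρ < a :=
    nhdsWithin_le_nhds (h1.eventually (gt_mem_nhds ha))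
  have h3 : ∀ᶠ ρ : ℝ≥0 in 𝓝[>] 0, ρ < δ := nhdsWithin_le_nhds (gt_mem_nhds hδ)
  have h4 : ∀ᶠ ρ : ℝ≥0 in 𝓝[>] 0, ρ < σ.toNNReal :=
    nhdsWithin_le_nhds (gt_mem_nhds (Real.toNNReal_pos.2 hσ))
  obtain ⟨ρ, h2, h3, h4, h5⟩ := (h2.and (h3.and (h4.and self_mem_nhdsWithin))).exists
  exact ⟨ρ, h5, h3.le, (Real.lt_toNNReal_iff_coe_lt.1 h4).le, h2⟩

namespace ExtendedDiscAlgebra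

theorem exists_dist_le_hausdorffPremeasure_lt {h : ℝ≥0 → ℝ≥0} (h0 : h 0 = 0)
    (hh : Filter.Tendsto h (𝓝 0) (𝓝 0)) (F : discAlgebra) {ε : ℝ} (hε : 0 < ε) {δ a : ℝ≥0}
    (hδ : 0 < δ) (ha : 0 < a) :
    ∃ G : discAlgebra, dist F G ≤ 5 * ε ∧ (∃ z w, ofDiscAlgebra G z ≠ ofDiscAlgebra G w) ∧
      hausdorffPremeasure h δ (ofDiscAlgebra G).exceptionalSet < a := by
  obtain ⟨η, hη, hF⟩ := Metric.uniformContinuous_iff.1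
    (CompactSpace.uniformContinuous_of_continuous F.1.continuous) (ε / 1000) (by positivity)
  obtain ⟨t', ht'sub, ht'fin, hcover⟩ := (isCompact_sphere (0 : ℂ) 1).finite_cover_balls hη
  lift t' to Finset ℂ using ht'fin
  rename Finset ℂ => t
  have ht (ζ : ℂ) (hζ : ζ ∈ t) : ‖ζ‖ = 1 := mem_sphere_zero_iff_norm.1 (ht'sub hζ)
  have hnet (z : ℂ) (hz : ‖z‖ = 1) : ∃ ζ ∈ t, dist z ζ < η := by
    simpa using hcover (mem_sphere_zero_iff_norm.2 hz)
  obtain ⟨σ, hσ, hsep⟩ := t.finite_toSet.exists_pos_le_dist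
  -- The net is already fixed, so `t.card * h ρ` can be made small; `ρ ≤ σ / 2` keeps the points of
  -- `t` separated by `2 * ρ`. The bump scale `τ` is chosen last.
  obtain ⟨ρ, hρ, hρδ, hρσ, hρa⟩ := exists_nnreal_mul_lt hh t.card ha hδ (half_pos hσ)
  have hρ' : (0 : ℝ) < ρ := hρ
  obtain ⟨τ, hτ, hτ1, hτρ, hτη, hsmall⟩ : ∃ τ : ℝ, 0 < τ ∧ τ ≤ 1 / 20 ∧ 4 * τ ≤ ρ ∧ 4 * τ < η ∧
      t.card * (8 * τ / ρ) ≤ 1 / 1000 := by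
    have h1 : ∀ᶠ τ : ℝ in 𝓝[>] 0, t.card * (8 * τ / ρ) < 1 / 1000 := by
      refine nhdsWithin_le_nhds (ContinuousAt.eventually_lt (f := fun τ : ℝ => t.card * (8 * τ / ρ))
        (by fun_prop) continuousAt_const (by simp))
    have h2 {b : ℝ} (hb : 0 < b) : ∀ᶠ τ : ℝ in 𝓝[>] 0, τ < b := nhdsWithin_le_nhds (gt_mem_nhds hb)
    obtain ⟨τ, h1, h2, h3, h4, h5⟩ := (h1.and ((h2 (b := 1 / 20) (by norm_num)).and
      ((h2 (b := ρ / 4) (by positivity)).and ((h2 (b := η / 4) (by positivity)).and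
        self_mem_nhdsWithin)))).exists
    exact ⟨τ, h5, h2.le, by linarith, by linarith, h1.le⟩
  have hcont : Continuous fun z : ClosedDisc => F.1 z + ε * decaySum t τ z := by
    refine F.1.continuous.add (continuous_const.mul ?_)
    rw [continuous_iff_continuousAt]
    intro z
    exact ContinuousAt.comp (g := decaySum t τ)
      (differentiableAt_decaySum hτ ht (ClosedDisc.norm_coe_le z)).continuousAt
      continuous_subtype_val.continuousAt
  have hmem : (⟨_, hcont⟩ : C(ClosedDisc, ℂ)) ∈ discAlgebra := by
    refine mem_discAlgebra_of_forall_eq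
      (g := fun z => F.1 (ClosedDisc.clamp z) + ε * decaySum t τ z) ?_ fun z _ => ?_
    · refine DifferentiableOn.add F.2 (DifferentiableOn.const_mul (fun z hz => ?_) _)
      exact (differentiableAt_decaySum hτ ht (mem_ball_zero_iff.1 hz).le).differentiableWithinAt
    · rw [ClosedDisc.clamp_coe]
      rfl
  obtain ⟨⟨z, w, hzw⟩, hvalues⟩ := forall_exists_eq_of_add_decaySum (F := F.1)
    (G := fun z => (⟨_, hcont⟩ : C(ClosedDisc, ℂ)) (ClosedDisc.clamp z)) hε hτ hτ1 hτρ hτη hsmall ht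
    (fun ζ hζ ξ hξ hne => by linarith [hsep ζ hζ ξ hξ hne]) hnet (fun z w => @hF z w) hmem
    (fun z => by rw [ClosedDisc.clamp_coe]; rfl)
  refine ⟨⟨⟨_, hcont⟩, hmem⟩, ?_, ⟨z, w, ?_⟩, ?_⟩
  · rw [Subtype.dist_eq, ContinuousMap.dist_le (by positivity)]
    intro z
    change dist (F.1 z) (F.1 z + ε * decaySum t τ z) ≤ _
    rw [dist_self_add_right, norm_mul, Complex.norm_real, Real.norm_eq_abs, abs_of_pos hε]
    -- At most one bump is large, bounded by `4`, and the others add at most `1 / 1000`; hence the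
    -- factor `5`.
    have := norm_decaySum_le_add hτ ht (ClosedDisc.norm_coe_le z) (show 2 * τ ≤ ρ by linarith)
      (fun ζ hζ ξ hξ hne => by linarith [hsep ζ hζ ξ hξ hne])
    nlinarith
  · simp only [ClosedDisc.clamp_coe] at hzw
    exact fun hcon => hzw (ExtendedPlane.ofComplex_injective hcon)
  · have hsub := exceptionalSet_ofDiscAlgebra_subset (F := ⟨⟨_, hcont⟩, hmem⟩)
      (U := ⋃ ζ ∈ t, Metric.ball ζ ρ) (by simpa only [ClosedDisc.clamp_coe] using hvalues)
    refine (hausdorffPremeasure_le_card_mul h0 hρδ t hsub).trans_lt ?_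
    exact_mod_cast hρa

/-- Baire's theorem is used in the complete space `discAlgebra`; completeness of $\tilde A(D)$ is
never needed, since a dense set is carried to a dense set by a continuous map of dense range. -/
theorem dense_setOf_hausdorffLambda_eq_zero {h : ℝ≥0 → ℝ≥0} (h0 : h 0 = 0)
    (hh : Filter.Tendsto h (𝓝 0) (𝓝 0)) :
    Dense {f : ExtendedDiscAlgebra | hausdorffLambda h f.exceptionalSet = 0} := by
  have : CompleteSpace discAlgebra := isClosed_discAlgebra.completeSpace_coe
  have key : Dense (⋂ n : ℕ, ofDiscAlgebra ⁻¹' {f | (∃ z w, f z ≠ f w) ∧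
      hausdorffPremeasure h ((n + 1 : ℝ≥0)⁻¹) f.exceptionalSet < ((n + 1 : ℝ≥0)⁻¹ : ℝ≥0)}) := by
    refine dense_iInter_of_isOpen_nat (fun n =>
      (isOpen_setOf_hausdorffPremeasure_lt _ _ _).preimage continuous_ofDiscAlgebra) fun n => ?_
    refine Metric.dense_iff.2 fun F r hr => ?_
    have hpos : (0 : ℝ≥0) < (n + 1 : ℝ≥0)⁻¹ := by positivity
    obtain ⟨G, hFG, hG⟩ := exists_dist_le_hausdorffPremeasure_lt h0 hh F
      (show 0 < r / 10 by positivity) hpos hpos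
    refine ⟨G, ?_, hG⟩
    rw [Metric.mem_ball, dist_comm]
    linarith
  refine (denseRange_ofDiscAlgebra.dense_image continuous_ofDiscAlgebra key).mono ?_
  rintro _ ⟨F, hF, rfl⟩
  rw [setOf_hausdorffLambda_eq_zero h0]
  exact Or.inr (Set.mem_iInter.2 fun n => Set.mem_iInter.1 hF n)

end ExtendedDiscAlgebra

theorem proposition4p3 :
    (∀ h : ℝ≥0 → ℝ≥0, IsHausdorffMeasureFunction h →
      Dense {f : ExtendedDiscAlgebra | hausdorffLambda h f.exceptionalSet = 0} ∧
      IsGδ {f : ExtendedDiscAlgebra | hausdorffLambda h f.exceptionalSet = 0}) ∧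
    (∀ᶠ f in residual ExtendedDiscAlgebra, circleLength f.exceptionalSet = 0) := by
  have key (h : ℝ≥0 → ℝ≥0) (hh : IsHausdorffMeasureFunction h) :
      Dense {f : ExtendedDiscAlgebra | hausdorffLambda h f.exceptionalSet = 0} ∧
      IsGδ {f : ExtendedDiscAlgebra | hausdorffLambda h f.exceptionalSet = 0} :=
    ⟨ExtendedDiscAlgebra.dense_setOf_hausdorffLambda_eq_zero hh.map_zero hh.tendsto_zero,
      ExtendedDiscAlgebra.isGδ_setOf_hausdorffLambda_eq_zero hh.map_zero⟩
  refine ⟨key, ?_⟩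
  obtain ⟨hd, hG⟩ := key id isHausdorffMeasureFunction_id
  exact Filter.mem_of_superset (residual_of_dense_Gδ hG hd) fun f hf =>
    circleLength_eq_zero_of_hausdorffLambda_id hf
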